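/- Let $\mathcal L$ be a complex Lie algebra of finite dimension $n\ge 3$, with basis $x_1,\dots,x_n$. Let $$Q_{\mathcal L}(z)=\det\bigl(z_0I+z_1\,\mathrm{ad}\,x_1+\cdots+z_n\,\mathrm{ad}\,x_n\bigr)\in\mathbb C[z_0,z_1,\dots,z_n]$$ be its characteristic polynomial with respect to this basis. It is divisible by $z_0$; put $Q^*_{\mathcal L}(z)=Q_{\mathcal L}(z)/z_0$. If $Q^*_{\mathcal L}$ is irreducible in $\mathbb C[z_0,\dots,z_n]$, then $\mathcal L$ is simple, i.e. $\mathcal L$ is non-abelian and its only ideals are $0$ and $\mathcal L$. -/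

import Mathlib

noncomputable section

namespace LieCharPoly

open MvPolynomial

/-- The linear pencil `z₀ I + z₁ T₁ + ⋯ + zₙ Tₙ`, where `Tᵢ` is the matrix of `ad xᵢ` in the basis
`x₁, …, xₙ`. The variable `z₀` is `X 0` and the variable attached to `b i` is `X i.succ`. -/
def adPencil {K L : Type*} [Field K] [LieRing L] [LieAlgebra K L] {n : ℕ}
    (b : Module.Basis (Fin n) K L) : Matrix (Fin n) (Fin n) (MvPolynomial (Fin (n + 1)) K) :=
  (X 0 : MvPolynomial (Fin (n + 1)) K) • 1 +
    ∑ i : Fin n, (X i.succ : MvPolynomial (Fin (n + 1)) K) •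
      (LinearMap.toMatrix b b (LieAlgebra.ad K L (b i))).map C

/-- The characteristic polynomial `Q_L(z) = det (z₀ I + z₁ ad x₁ + ⋯ + zₙ ad xₙ)` of `L` with
respect to the basis `x₁, …, xₙ`. -/
def Q {K L : Type*} [Field K] [LieRing L] [LieAlgebra K L] {n : ℕ}
    (b : Module.Basis (Fin n) K L) : MvPolynomial (Fin (n + 1)) K :=
  (adPencil b).det

/-- The polynomial `Q*_L(z) = Q_L(z) / z₀`; the division is exact as soon as `L ≠ 0`,
see `X_zero_mul_QStar`. -/
def QStar {K L : Type*} [Field K] [LieRing L] [LieAlgebra K L] {n : ℕ}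
    (b : Module.Basis (Fin n) K L) : MvPolynomial (Fin (n + 1)) K :=
  (Q b).divMonomial (Finsupp.single 0 1)

/-- The generic element `z₁ x₁ + ⋯ + zₙ xₙ` lies in the kernel of `z₁ ad x₁ + ⋯ + zₙ ad xₙ`. -/
theorem adPencil_mulVec {K L : Type*} [Field K] [LieRing L] [LieAlgebra K L] {n : ℕ}
    (b : Module.Basis (Fin n) K L) :
    (adPencil b).mulVec (fun i => X i.succ) =
      (X 0 : MvPolynomial (Fin (n + 1)) K) • (fun i => X i.succ) := by
  have key : ∀ k, ∑ i : Fin n, ∑ j : Fin n, (X i.succ : MvPolynomial (Fin (n + 1)) K) *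
      (C (b.repr ⁅b i, b j⁆ k) * X j.succ) = 0 := by
    intro k
    rw [← Finset.sum_product']
    refine Finset.sum_involution (fun p _ => (p.2, p.1)) ?_ ?_ ?_ ?_
    · rintro ⟨i, j⟩ -
      simp only
      rw [← lie_skew (b i) (b j)]
      simp only [map_neg, Finsupp.neg_apply]
      ring
    · rintro ⟨i, j⟩ - h h'
      obtain rfl : j = i := congrArg Prod.fst h'
      simp at h
    · simp
    · simp
  rw [adPencil, Matrix.add_mulVec, Matrix.smul_mulVec, Matrix.one_mulVec, Matrix.sum_mulVec,
    add_eq_left]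
  ext1 k
  rw [Finset.sum_apply]
  refine Eq.trans (Finset.sum_congr rfl fun i _ => ?_) (key k)
  rw [Matrix.smul_mulVec, Pi.smul_apply, smul_eq_mul, Matrix.mulVec, dotProduct, Finset.mul_sum]
  refine Finset.sum_congr rfl fun j _ => ?_
  rw [Matrix.map_apply, LinearMap.toMatrix_apply, LieAlgebra.ad_apply]

/-- `z₀` divides the characteristic polynomial of a nonzero Lie algebra, so that `QStar` is the
exact quotient. -/
theorem X_zero_mul_QStar {K L : Type*} [Field K] [LieRing L] [LieAlgebra K L] {n : ℕ}
    (hn : 0 < n) (b : Module.Basis (Fin n) K L) : X 0 * QStar b = Q b := by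
  have h : (X 0 : MvPolynomial (Fin (n + 1)) K) ∣ Q b * X (Fin.succ ⟨0, hn⟩) := by
    have h1 := congrArg (fun v => (adPencil b).adjugate.mulVec v ⟨0, hn⟩) (adPencil_mulVec b)
    simp only [Matrix.mulVec_mulVec, Matrix.adjugate_mul, Matrix.smul_mulVec, Matrix.one_mulVec,
      Matrix.mulVec_smul, Pi.smul_apply, smul_eq_mul] at h1
    exact ⟨_, h1⟩
  have hd : (X 0 : MvPolynomial (Fin (n + 1)) K) ∣ Q b := by
    refine ((X_prime (R := K) (i := (0 : Fin (n + 1)))).dvd_or_dvd h).resolve_right ?_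
    rw [X_dvd_X]
    simp [Fin.ext_iff]
  obtain ⟨q, hq⟩ := hd
  rw [QStar, hq]
  congr 1
  exact X_mul_divMonomial 0 q

end LieCharPoly

end

/-!
For an ideal `I`, the characteristic polynomial of `L` is the product of those of the `L`-modules
`I` and `L ⧸ I`. The second factor is divisible by `z₀`, because `ad y` is singular for every `y` in
the nonzero Lie algebra `L ⧸ I`. Sending `z₀ ↦ t` and `zᵢ ↦ 0` turns the characteristic polynomial
of a module of dimension `d` into `t ^ d`; so if `Q*` is irreducible, then every proper nonzero
ideal has codimension one, and in dimension at least three no ideal is a line. By Lie's theorem `L`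
is not solvable. A nonzero radical would have codimension one, making `L` solvable; hence `L` is
semisimple. Finally, a complement to a proper nonzero ideal would be an ideal that is a line.
-/

noncomputable section

namespace LieCharPoly

open Module MvPolynomial LieModule LieAlgebra

section Pencil

/-- The linear pencil `z₀ + z₁ T₁ + ⋯ + zₙ Tₙ` in a `K`-algebra. Taking `z` to be the variables `X`
gives generic pencils such as `adPencil`; taking `z` in `K` gives their specializations. -/
def pencil {K A : Type*} [CommSemiring K] [Semiring A] [Algebra K A] {n : ℕ}
    (z : Fin (n + 1) → K) (T : Fin n → A) : A :=
  z 0 • 1 + ∑ i, z i.succ • T i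

theorem map_pencil {K A B F : Type*} [CommSemiring K] [Semiring A] [Algebra K A] [Semiring B]
    [Algebra K B] [FunLike F A B] [AlgHomClass F K A B] {n : ℕ} (f : F) (z : Fin (n + 1) → K)
    (T : Fin n → A) : f (pencil z T) = pencil z (f ∘ T) := by
  simp [pencil]

theorem pencil_cons_zero {K A : Type*} [CommSemiring K] [Semiring A] [Algebra K A] {n : ℕ} (t : K)
    (T : Fin n → A) : pencil (Fin.cons t 0) T = t • 1 := by
  simp [pencil]

/-- The generic pencil `z₀ I + z₁ A₁ + ⋯ + zₙ Aₙ` of a tuple of matrices, with the variables `X` as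
coefficients. For `Aᵢ` the matrix of `ad xᵢ` in the basis of the `xᵢ` it is `adPencil`. -/
def genericPencil {K ι : Type*} [CommRing K] [Fintype ι] [DecidableEq ι] {n : ℕ}
    (A : Fin n → Matrix ι ι K) : Matrix ι ι (MvPolynomial (Fin (n + 1)) K) :=
  pencil (K := MvPolynomial (Fin (n + 1)) K) X fun i => (A i).map C

theorem aeval_det_genericPencil {K S ι : Type*} [CommRing K] [CommRing S] [Algebra K S] [Fintype ι]
    [DecidableEq ι] {n : ℕ} (A : Fin n → Matrix ι ι K) (z : Fin (n + 1) → S) :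
    aeval z (genericPencil A).det = (pencil z fun i => (A i).map (algebraMap K S)).det := by
  rw [AlgHom.map_det]
  congr 1
  ext j k
  simp [genericPencil, pencil, Matrix.sum_apply, Matrix.one_apply, apply_ite (aeval z)]

theorem eval_det_genericPencil_toMatrix {K V ι : Type*} [CommRing K] [AddCommGroup V] [Module K V]
    [Fintype ι] [DecidableEq ι] {n : ℕ} (c : Basis ι K V) (T : Fin n → End K V)
    (z : Fin (n + 1) → K) :
    eval z (genericPencil fun i => LinearMap.toMatrix c c (T i)).det =
      LinearMap.det (pencil z T) := by
  rw [← LinearMap.det_toMatrix c, ← coe_aeval_eq_eval, RingHom.coe_coe, aeval_det_genericPencil]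
  exact congrArg Matrix.det (map_pencil (LinearMap.toMatrixAlgEquiv c) z T).symm

end Pencil

section JointCharpoly

variable {K V : Type*} [Field K] [AddCommGroup V] [Module K V] [Module.Finite K V]
  {n : ℕ}

/-- The characteristic polynomial `det (z₀ I + z₁ T₁ + ⋯ + zₙ Tₙ)` of a tuple of endomorphisms,
computed in the basis `Module.finBasis K V`. It generalizes `Q` from the tuple `ad xᵢ` to the
actions of the `xᵢ` on ideals and quotients of a Lie algebra. -/
def jointCharpoly (T : Fin n → End K V) : MvPolynomial (Fin (n + 1)) K :=
  (genericPencil fun i => LinearMap.toMatrix (finBasis K V) (finBasis K V) (T i)).det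

theorem eval_jointCharpoly (T : Fin n → End K V) (z : Fin (n + 1) → K) :
    eval z (jointCharpoly T) = LinearMap.det (pencil z T) :=
  eval_det_genericPencil_toMatrix _ T z

theorem jointCharpoly_eq_mul [Infinite K] (T : Fin n → End K V) (W : Submodule K V)
    (hW : ∀ i, W ≤ W.comap (T i)) :
    jointCharpoly T =
      jointCharpoly (fun i => (T i).restrict (hW i)) *
        jointCharpoly (fun i => W.mapQ W (T i) (hW i)) := by
  refine MvPolynomial.funext fun z => ?_
  have hz : W ≤ W.comap (pencil z T) := fun w hw => by
    simpa [pencil] using W.add_mem (W.smul_mem _ hw)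
      (W.sum_mem fun i _ => W.smul_mem _ (hW i hw))
  have hsub : (pencil z T).restrict hz = pencil z fun i => (T i).restrict (hW i) := by
    ext w
    simp [pencil]
  have hquot : W.mapQ W (pencil z T) hz = pencil z fun i => W.mapQ W (T i) (hW i) := by
    ext v
    simp only [pencil, LinearMap.comp_apply, Submodule.mkQ_apply, Submodule.mapQ_apply,
      LinearMap.add_apply, LinearMap.smul_apply, LinearMap.sum_apply, End.one_apply]
    simp only [← Submodule.mkQ_apply, map_add, map_smul, map_sum]
  rw [map_mul, eval_jointCharpoly, eval_jointCharpoly, eval_jointCharpoly,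
    LinearMap.det_eq_det_mul_det W _ hz, hsub, hquot]

theorem aeval_cons_X_zero_jointCharpoly (T : Fin n → End K V) :
    aeval (Fin.cons Polynomial.X 0 : Fin (n + 1) → Polynomial K) (jointCharpoly T) =
      Polynomial.X ^ finrank K V := by
  rw [jointCharpoly, aeval_det_genericPencil, pencil_cons_zero, Matrix.det_smul, Matrix.det_one,
    mul_one, Fintype.card_fin]

theorem finrank_eq_zero_of_isUnit_jointCharpoly {T : Fin n → End K V}
    (h : IsUnit (jointCharpoly T)) : finrank K V = 0 := by
  have hunit := h.map (aeval (Fin.cons Polynomial.X 0 : Fin (n + 1) → Polynomial K))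
  rw [aeval_cons_X_zero_jointCharpoly] at hunit
  simpa using Polynomial.natDegree_eq_zero_of_isUnit hunit

theorem finrank_eq_one_of_jointCharpoly_eq_X_zero_mul {T : Fin n → End K V}
    {u : MvPolynomial (Fin (n + 1)) K} (hu : IsUnit u) (h : jointCharpoly T = X 0 * u) :
    finrank K V = 1 := by
  let φ := aeval (R := K) (Fin.cons Polynomial.X 0 : Fin (n + 1) → Polynomial K)
  have hφ : Polynomial.X ^ finrank K V = Polynomial.X * φ u := by
    simpa [φ, aeval_cons_X_zero_jointCharpoly] using congrArg φ h
  have hunit : IsUnit (φ u) := hu.map φ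
  simpa [Polynomial.natDegree_X_mul hunit.ne_zero, Polynomial.natDegree_eq_zero_of_isUnit hunit]
    using congrArg Polynomial.natDegree hφ

theorem X_zero_dvd_of_forall_eval_cons_zero {K : Type*} [CommRing K] [IsDomain K] [Infinite K]
    {p : MvPolynomial (Fin (n + 1)) K} (h : ∀ a : Fin n → K, eval (Fin.cons 0 a) p = 0) :
    X 0 ∣ p := by
  rw [← map_dvd_iff (finSuccEquiv K n), finSuccEquiv_X_zero, Polynomial.X_dvd_iff]
  refine MvPolynomial.funext fun a => ?_
  simpa [eval_eq_eval_mv_eval', ← Polynomial.coeff_zero_eq_eval_zero] using h a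

end JointCharpoly

section LieIdeal

variable {K L : Type*} [Field K] [LieRing L] [LieAlgebra K L]

theorem Q_eq_jointCharpoly [Infinite K] [Module.Finite K L] {n : ℕ} (b : Basis (Fin n) K L) :
    Q b = jointCharpoly fun i => toEnd K L L (b i) :=
  MvPolynomial.funext fun z =>
    (eval_det_genericPencil_toMatrix b _ z).trans (eval_jointCharpoly _ z).symm

theorem det_ad_eq_zero [Module.Finite K L] [Nontrivial L] (x : L) :
    LinearMap.det (ad K L x) = 0 := by
  obtain rfl | hx := eq_or_ne x 0
  · simp
  · rw [LinearMap.det_eq_zero_iff_ker_ne_bot, Submodule.ne_bot_iff]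
    exact ⟨x, by simp, hx⟩

theorem toEnd_quotient_eq_ad {K L : Type*} [CommRing K] [LieRing L] [LieAlgebra K L]
    (I : LieIdeal K L) (x : L) :
    toEnd K L (L ⧸ I) x = ad K (L ⧸ I) (LieSubmodule.Quotient.mk x) := by
  ext y
  obtain ⟨y, rfl⟩ := LieSubmodule.Quotient.surjective_mk' I y
  rfl

variable [Infinite K] {n : ℕ}

theorem jointCharpoly_toEnd_eq_mul {M : Type*} [AddCommGroup M] [Module K M] [Module.Finite K M]
    [LieRingModule L M] [LieModule K L M] (N : LieSubmodule K L M) (x : Fin n → L) :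
    jointCharpoly (fun i => toEnd K L M (x i)) =
      jointCharpoly (fun i => toEnd K L N (x i)) *
        jointCharpoly (fun i => toEnd K L (M ⧸ N) (x i)) :=
  jointCharpoly_eq_mul _ N.toSubmodule fun _ _ hm => N.lie_mem hm

variable [Module.Finite K L]

theorem X_zero_dvd_jointCharpoly_quotient {I : LieIdeal K L} (hI : I ≠ ⊤) (x : Fin n → L) :
    X 0 ∣ jointCharpoly fun i => toEnd K L (L ⧸ I) (x i) := by
  have : Nontrivial (L ⧸ I) := Submodule.Quotient.nontrivial_iff.2 (by simpa using hI)
  refine X_zero_dvd_of_forall_eval_cons_zero fun a => ?_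
  have hpencil : pencil (Fin.cons 0 a) (fun i => toEnd K L (L ⧸ I) (x i)) =
      ad K (L ⧸ I) (∑ i, a i • LieSubmodule.Quotient.mk (x i)) := by
    simp [pencil, toEnd_quotient_eq_ad]
  rw [eval_jointCharpoly, hpencil, det_ad_eq_zero]

theorem finrank_quotient_eq_one_of_irreducible_QStar (b : Basis (Fin n) K L)
    (hirr : Irreducible (QStar b)) {I : LieIdeal K L} (hbot : I ≠ ⊥) (htop : I ≠ ⊤) :
    finrank K (L ⧸ I) = 1 := by
  obtain ⟨R, hR⟩ := X_zero_dvd_jointCharpoly_quotient htop b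
  have hn : 0 < n := by
    have : Nontrivial L := (LieSubmodule.nontrivial_iff K L L).1 ⟨I, ⊥, hbot⟩
    exact Fin.pos_iff_nonempty.2 b.index_nonempty
  have hfac : QStar b = jointCharpoly (fun i => toEnd K L I (b i)) * R := by
    refine mul_left_cancel₀ (X_ne_zero (R := K) (0 : Fin (n + 1))) ?_
    rw [X_zero_mul_QStar hn, Q_eq_jointCharpoly, jointCharpoly_toEnd_eq_mul I, hR, mul_left_comm]
  refine finrank_eq_one_of_jointCharpoly_eq_X_zero_mul
    ((hirr.isUnit_or_isUnit hfac).resolve_left fun hunit => hbot ?_) hR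
  rw [← LieSubmodule.toSubmodule_eq_bot, ← Submodule.finrank_eq_zero (R := K)]
  exact finrank_eq_zero_of_isUnit_jointCharpoly hunit

end LieIdeal

section Simplicity

variable {K L : Type*} [LieRing L]

theorem isLieAbelian_of_finrank_eq_one [CommRing K] [StrongRankCondition K] [LieAlgebra K L]
    [Module.Free K L] (h : finrank K L = 1) : IsLieAbelian L := by
  obtain ⟨v, -, hv⟩ := finrank_eq_one_iff'.1 h
  refine ⟨fun x y => ?_⟩
  obtain ⟨⟨s, rfl⟩, t, rfl⟩ := And.intro (hv x) (hv y)
  simp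

theorem isSolvable_of_isSolvable_quotient [CommRing K] [LieAlgebra K L] (I : LieIdeal K L)
    [IsSolvable I] [IsSolvable (L ⧸ I)] : IsSolvable L := by
  obtain ⟨k, hk⟩ := IsSolvable.solvable K I
  obtain ⟨l, hl⟩ := IsSolvable.solvable K (L ⧸ I)
  have hle : derivedSeries K L l ≤ I := by
    let f : L →ₗ⁅K⁆ L ⧸ I := { LieSubmodule.Quotient.mk' I with map_lie' := rfl }
    have hf : f.ker = I := by
      ext
      exact LieSubmodule.Quotient.mk_eq_zero I
    rw [← hf, ← LieIdeal.map_eq_bot_iff, ← le_bot_iff, ← hl]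
    exact LieIdeal.derivedSeries_map_le l
  refine IsSolvable.mk (R := K) (k := k + l) ?_
  rw [LieIdeal.derivedSeries_eq_bot_iff] at hk
  rw [derivedSeries_def, derivedSeriesOfIdeal_add, ← le_bot_iff, ← hk]
  exact derivedSeriesOfIdeal_mono hle k

theorem finrank_eq_finrank_quotient_of_isCompl [CommRing K] [LieAlgebra K L]
    {I J : LieIdeal K L} (h : IsCompl I J) :
    finrank K J = finrank K (L ⧸ I) :=
  (Submodule.quotientEquivOfIsCompl _ _ (LieSubmodule.isCompl_toSubmodule.2 h)).finrank_eq.symm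

variable [Field K] [LieAlgebra K L]

/-- Lie's theorem for the adjoint representation: a common eigenvector spans an ideal. -/
theorem exists_lieIdeal_finrank_eq_one [CharZero K] [Module.Finite K L] [Nontrivial L]
    [IsSolvable L] [IsTriangularizable K L L] : ∃ I : LieIdeal K L, finrank K I = 1 := by
  obtain ⟨χ, hχ⟩ := exists_nontrivial_weightSpace_of_isSolvable K L L
  obtain ⟨⟨v, hv⟩, hv0⟩ := exists_ne (0 : weightSpace L χ)
  rw [mem_weightSpace] at hv
  let I : LieIdeal K L :=
    { K ∙ v with
      lie_mem := by
        intro x w hw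
        obtain ⟨s, rfl⟩ := Submodule.mem_span_singleton.1 hw
        rw [lie_smul, hv]
        exact (K ∙ v).smul_mem _ ((K ∙ v).smul_mem _ (Submodule.mem_span_singleton_self v)) }
  exact ⟨I, finrank_span_singleton (by simpa using hv0)⟩

theorem isSimple_of_forall_finrank_quotient_eq_one [CharZero K] [Module.Finite K L]
    [IsTriangularizable K L L] (hdim : 3 ≤ finrank K L)
    (h : ∀ I : LieIdeal K L, I ≠ ⊥ → I ≠ ⊤ → finrank K (L ⧸ I) = 1) : IsSimple K L := by
  have : Nontrivial L := nontrivial_of_finrank_pos (R := K) (by lia)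
  have hline (J : LieIdeal K L) : finrank K J ≠ 1 := by
    intro hJ
    have hadd : finrank K (L ⧸ J) + finrank K J = finrank K L :=
      J.toSubmodule.finrank_quotient_add_finrank
    have hbot : J ≠ ⊥ := by
      rintro rfl
      exact zero_ne_one ((finrank_bot K L).symm.trans hJ)
    have htop : J ≠ ⊤ := by
      rintro rfl
      have : finrank K (⊤ : LieIdeal K L) = finrank K L := finrank_top K L
      lia
    have := h J hbot htop
    lia
  have hsolv : ¬ IsSolvable L := fun _ =>
    let ⟨J, hJ⟩ := exists_lieIdeal_finrank_eq_one (K := K) (L := L)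
    hline J hJ
  have hrad : radical K L = ⊥ := by
    by_contra hbot
    have htop : radical K L ≠ ⊤ := by
      intro htop
      have : IsSolvable (⊤ : LieIdeal K L) := htop ▸ inferInstance
      exact hsolv ((solvable_iff_equiv_solvable LieIdeal.topEquiv).1 this)
    have := isLieAbelian_of_finrank_eq_one (h _ hbot htop)
    exact hsolv (isSolvable_of_isSolvable_quotient (radical K L))
  have : HasTrivialRadical K L := ⟨hrad⟩
  refine ⟨fun I => ?_, fun _ => hsolv inferInstance⟩
  by_contra! ⟨hbot, htop⟩
  obtain ⟨J, hJ⟩ := exists_isCompl I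
  exact hline J ((finrank_eq_finrank_quotient_of_isCompl hJ).trans (h I hbot htop))

end Simplicity

end LieCharPoly

end

theorem mainTheorem4_general {K L : Type*} [Field K] [CharZero K] [LieRing L] [LieAlgebra K L]
    [LieModule.IsTriangularizable K L L] {n : ℕ} (hn : 3 ≤ n) (b : Module.Basis (Fin n) K L)
    (hirr : Irreducible (LieCharPoly.QStar b)) : LieAlgebra.IsSimple K L := by
  have : Module.Finite K L := .of_basis b
  refine LieCharPoly.isSimple_of_forall_finrank_quotient_eq_one ?_ fun _ hbot htop =>
    LieCharPoly.finrank_quotient_eq_one_of_irreducible_QStar b hirr hbot htop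
  rwa [Module.finrank_eq_card_basis b, Fintype.card_fin]

theorem mainTheorem4 {L : Type*} [LieRing L] [LieAlgebra ℂ L] {n : ℕ} (hn : 3 ≤ n)
    (b : Module.Basis (Fin n) ℂ L) (hirr : Irreducible (LieCharPoly.QStar b)) :
    LieAlgebra.IsSimple ℂ L :=
  have : Module.Finite ℂ L := .of_basis b
  mainTheorem4_general hn b hirr
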